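/- Let $(V,\langle\cdot,\cdot\rangle)$ be a finite-dimensional real inner product space with an orthogonal almost complex structure $J$ (a linear map with $J^2=-\mathrm{Id}$ and $\langle Jx,Jy\rangle=\langle x,y\rangle$). An algebraic curvature tensor on $V$ is a trilinear map $R:V^3\to V$, $(x,y,z)\mapsto R(x,y)z$, with $\langle R(x,y)z,w\rangle=-\langle R(y,x)z,w\rangle=\langle R(z,w)x,y\rangle$ and $R(x,y)z+R(y,z)x+R(z,x)y=0$. It is Kähler if $R(x,y)z=R(Jx,Jy)z$ for all $x,y,z$, and almost isotropic with constant $\kappa\in\mathbb R$ if for each unit vector $v$ the Jacobi operator $\mathcal J_v:v^\perp\to v^\perp$, $\mathcal J_v(w)=R(w,v)v$, satisfies $\operatorname{rank}(\mathcal J_v-\kappa\,\mathrm{Id}_{v^\perp})\le 1$. Put $$R_1(x,y)z=\langle y,z\rangle x-\langle x,z\rangle y,\qquad R_A(x,y)z=2\langle x,Ay\rangle Az+\langle x,Az\rangle Ay-\langle y,Az\rangle Ax$$ for a skew-symmetric endomorphism $A$ of $V$. A holomorphic plane is a two-dimensional $J$-invariant subspace, and $\pi^W$ is the orthogonal projection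 of $V$ onto a subspace $W$. Let $R:V^3\to V$ be trilinear and $\kappa\in\mathbb R$. 1. Suppose $\dim V=2$. Then $R$ is a Kähler algebraic curvature tensor that is almost isotropic with constant $\kappa$ (a rank condition that is then satisfied by every $\kappa$) if and only if there is a unique $\kappa_0\in\mathbb R$ with $R=\kappa_0R_1=\frac{\kappa_0}{4}(R_1+R_J)$. Moreover, $R$ is such a tensor and $\kappa$ is its sectional curvature (that is, $\langle R(x,y)y,x\rangle=\kappa$ for all orthonormal $x,y$) if and only if $R=\kappa R_1=\frac{\kappa}{4}(R_1+R_J)$. 2. If $\dim V=4$ and $\kappa\ne0$, then $R$ is a Kähler algebraic curvature tensor that is almost isotropic with constant $\kappa$ if and only if there are $\tau\in\{1,-1\}$, $\mu_1,\mu_2\in\mathbb R$ and orthogonal holomorphic planes $W_1,W_2$ such that $\mu_1\mu_2=\kappa/\tau$ and $R=\kappa R_1+\tau R_A$ with $A=J\circ(\mu_1\pi^{W_1}+\mu_2\pi^{W_2})$. 3. If $\dim V\ge6$ and $\kappa\ne0$, then $R$ is a Kähler algebraic curvature tensor that is almost isotropic with constant $\kappa$ if and only if $R=\kappa(R_1+R_J)$.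 4. If $\dim V\ge4$ and $\kappa=0$, then $R$ is a Kähler algebraic curvature tensor that is almost isotropic with constant $\kappa=0$ if and only if there are $c\in\mathbb R$ and a holomorphic plane $W$ such that $R=cR_A$ with $A=J\circ\pi^W$. -/

import Mathlib

open scoped InnerProductSpace

namespace AlmostIso

section
variable {V : Type*} [NormedAddCommGroup V] [InnerProductSpace ℝ V]

/-- Trilinear maps `(x, y, z) ↦ R x y z`, written `R(x,y)z` in the literature. -/
abbrev Tensor (V : Type*) [NormedAddCommGroup V] [InnerProductSpace ℝ V] : Type _ :=
  V →ₗ[ℝ] V →ₗ[ℝ] V →ₗ[ℝ] V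

/-- The curvature symmetries. -/
structure IsAlgebraicCurvature (R : Tensor V) : Prop where
  antisymm : ∀ x y z w : V, ⟪R x y z, w⟫_ℝ = -⟪R y x z, w⟫_ℝ
  pair_symm : ∀ x y z w : V, ⟪R x y z, w⟫_ℝ = ⟪R z w x, y⟫_ℝ
  bianchi : ∀ x y z : V, R x y z + R y z x + R z x y = 0

/-- The tensor `R₁(x,y)z = ⟨y,z⟩ x - ⟨x,z⟩ y`. -/
noncomputable def tensorOne (V : Type*) [NormedAddCommGroup V] [InnerProductSpace ℝ V] :
    Tensor V :=
  LinearMap.mk₂ ℝ (fun x y => (innerₗ V y).smulRight x - (innerₗ V x).smulRight y)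
    (fun x x' y => by ext z; simp [add_smul]; abel)
    (fun c x y => by ext z; simp [smul_sub, smul_smul, mul_comm])
    (fun x y y' => by ext z; simp [add_smul]; abel)
    (fun c x y => by ext z; simp [smul_sub, smul_smul, mul_comm])

/-- The tensor `R_A(x,y)z = 2⟨x,Ay⟩ Az + ⟨x,Az⟩ Ay - ⟨y,Az⟩ Ax`. -/
noncomputable def tensorOf (A : V →ₗ[ℝ] V) : Tensor V :=
  LinearMap.mk₂ ℝ
    (fun x y => (2 * ⟪x, A y⟫_ℝ) • A + ((innerₗ V x) ∘ₗ A).smulRight (A y)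
      - ((innerₗ V y) ∘ₗ A).smulRight (A x))
    (fun x x' y => by
      ext z; simp [inner_add_left, add_smul, mul_add]; abel)
    (fun c x y => by
      ext z; simp [inner_smul_left, smul_sub, smul_smul, mul_comm, mul_left_comm])
    (fun x y y' => by
      ext z; simp [inner_add_right, add_smul, mul_add]; abel)
    (fun c x y => by
      ext z
      simp [inner_smul_right, smul_sub, smul_smul, mul_comm, mul_left_comm])

theorem tensorOne_apply (x y z : V) :
    tensorOne V x y z = ⟪y, z⟫_ℝ • x - ⟪x, z⟫_ℝ • y := by
  simp [tensorOne]

theorem tensorOf_apply (A : V →ₗ[ℝ] V) (x y z : V) :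
    tensorOf A x y z =
      (2 * ⟪x, A y⟫_ℝ) • A z + ⟪x, A z⟫_ℝ • A y - ⟪y, A z⟫_ℝ • A x := by
  simp [tensorOf]

theorem IsAlgebraicCurvature.jacobi_mem {R : Tensor V} (hR : IsAlgebraicCurvature R)
    (v w : V) : R w v v ∈ (ℝ ∙ v)ᗮ := by
  rw [Submodule.mem_orthogonal_singleton_iff_inner_left]
  have h1 := hR.pair_symm w v v v
  have h2 := hR.antisymm v v w v
  linarith

/-- The Jacobi operator `w ↦ R(w,v)v`, an endomorphism of the orthogonal complement of `v`. -/
noncomputable def jacobiOperator {R : Tensor V} (hR : IsAlgebraicCurvature R) (v : V) :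
    (ℝ ∙ v)ᗮ →ₗ[ℝ] (ℝ ∙ v)ᗮ :=
  LinearMap.codRestrict (ℝ ∙ v)ᗮ (((R.flip v).flip v) ∘ₗ (ℝ ∙ v)ᗮ.subtype)
    (fun w => hR.jacobi_mem v w)

theorem jacobiOperator_apply {R : Tensor V} (hR : IsAlgebraicCurvature R) (v : V)
    (w : (ℝ ∙ v)ᗮ) : (jacobiOperator hR v w : V) = R w v v := rfl

/-- `R` is almost isotropic with constant `κ`: `rank (𝒥_v - κ Id) ≤ 1` for all unit `v`. -/
def IsAlmostIsotropicWith {R : Tensor V} (hR : IsAlgebraicCurvature R) (κ : ℝ) : Prop :=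
  ∀ v : V, ‖v‖ = 1 → (jacobiOperator hR v - κ • LinearMap.id).rank ≤ 1

/-- All two-dimensional subspaces have sectional curvature `κ`. -/
def HasSectionalCurvature (R : Tensor V) (κ : ℝ) : Prop :=
  ∀ x y : V, ‖x‖ = 1 → ‖y‖ = 1 → ⟪x, y⟫_ℝ = 0 → ⟪R x y y, x⟫_ℝ = κ

/-- An orthogonal almost complex structure. -/
structure IsOrthogonalComplexStructure (J : V →ₗ[ℝ] V) : Prop where
  sq : ∀ x : V, J (J x) = -x
  orthogonal : ∀ x y : V, ⟪J x, J y⟫_ℝ = ⟪x, y⟫_ℝ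

/-- The Kähler symmetry `R(x,y)z = R(Jx,Jy)z`. -/
def IsKahler (J : V →ₗ[ℝ] V) (R : Tensor V) : Prop :=
  ∀ x y z : V, R x y z = R (J x) (J y) z

/-- A holomorphic plane: a two-dimensional `J`-invariant subspace. -/
structure IsHolomorphicPlane (J : V →ₗ[ℝ] V) (W : Submodule ℝ V) : Prop where
  finrank_eq : Module.finrank ℝ W = 2
  invariant : ∀ w ∈ W, J w ∈ W

/-- Orthogonal projection onto `W`, viewed as an endomorphism of `V`. -/
noncomputable def proj [FiniteDimensional ℝ V] (W : Submodule ℝ V) : V →ₗ[ℝ] V :=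
  W.starProjection.toLinearMap

/-- `R` is a Kähler algebraic curvature tensor that is almost isotropic with constant `κ`. -/
def IsKahlerAlmostIsotropic (J : V →ₗ[ℝ] V) (R : Tensor V) (κ : ℝ) : Prop :=
  ∃ hR : IsAlgebraicCurvature R, IsKahler J R ∧ IsAlmostIsotropicWith hR κ

end

end AlmostIso

/-! Write `T = R - κ R₁`. Almost isotropy says that for every `v` the self-adjoint operator
`T(·,v)v` has rank at most one, so its 2×2 minors vanish (`sq_eq_mul`). Pure algebra then gives `T =
τ R_A` with `A` skew and `τ = ±1` (`exists_eq_smul_tensorOf`): the rank-one form `T(·,v)v` is `τ⟨l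
v,·⟩²`, the point being that the vector `l v` can be chosen linearly in `v`. Linearity comes from
fixing `x₀` and dividing the quadratic map `v ↦ T(x₀,v)v` by a linear form `lam` on whose kernel it
vanishes. Skewness of `l` is then just `T(x,x) = 0`.

The Kähler symmetry makes sectional curvature `J`-invariant, which forces `A J = ± J A`; the minus
sign is possible only for `A = 0`. Hence `A = J S` with `S` symmetric and commuting with `J`, and
the Kähler identity becomes a rule for eigenvectors (`exists_symmetric`): if `S y = μ y` with `y` a
unit vector, then `κ x = τ μ S x` for all `x ⟂ y, J y`.

One eigenvector with `μ ≠ 0` therefore fixes `S`: it is `μ` on the plane of `y, J y` and `κ/(τμ)` on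
the complement. In dimension 4 this is the two-plane form. From dimension 6 on, the rule applied
inside the complement makes all eigenvalues equal. For `κ = 0` the complement is killed. In
dimension 2 one sectional curvature determines everything.

Conversely, the Kähler identity for `κ R₁ + τ R_{JS}` amounts to `κ(x∧y - Jx∧Jy) = τ(Sx∧Sy -
JSx∧JSy)`, checked on each normal form. -/

namespace AlmostIso

/-! ### Curvature tensors with rank-one Jacobi operators -/

section Curvature
variable {V : Type*} [NormedAddCommGroup V] [InnerProductSpace ℝ V]

namespace IsAlgebraicCurvature
variable {R T : Tensor V}

theorem antisymm_right (hR : IsAlgebraicCurvature R) (x y z w : V) :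
    ⟪R x y z, w⟫_ℝ = -⟪R x y w, z⟫_ℝ := by
  rw [hR.pair_symm x y z w, hR.antisymm z w x y, hR.pair_symm w z x y]

theorem jacobi_symm (hR : IsAlgebraicCurvature R) (v x y : V) :
    ⟪R x v v, y⟫_ℝ = ⟪R y v v, x⟫_ℝ := by
  rw [hR.pair_symm x v v y, hR.antisymm v y x v, hR.antisymm_right y v x v, neg_neg]

theorem swap (hR : IsAlgebraicCurvature R) (x y : V) : R x y = -R y x := by
  ext z
  exact ext_inner_right ℝ fun w => by
    rw [hR.antisymm, LinearMap.neg_apply, inner_neg_left]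

theorem apply_self (hR : IsAlgebraicCurvature R) (x : V) : R x x = 0 :=
  LinearMap.ext fun z => ext_inner_right ℝ fun w => by
    rw [LinearMap.zero_apply, inner_zero_left]
    linarith [hR.antisymm x x z w]

theorem add (hR : IsAlgebraicCurvature R) (hT : IsAlgebraicCurvature T) :
    IsAlgebraicCurvature (R + T) where
  antisymm x y z w := by
    simp only [LinearMap.add_apply, inner_add_left, hR.antisymm x y, hT.antisymm x y]; ring
  pair_symm x y z w := by
    simp only [LinearMap.add_apply, inner_add_left, hR.pair_symm x y, hT.pair_symm x y]
  bianchi x y z := by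
    have h := congrArg₂ (· + ·) (hR.bianchi x y z) (hT.bianchi x y z)
    simp only [LinearMap.add_apply]
    rw [← add_zero (0 : V), ← h]; abel

theorem smul (c : ℝ) (hR : IsAlgebraicCurvature R) : IsAlgebraicCurvature (c • R) where
  antisymm x y z w := by
    simp only [LinearMap.smul_apply, real_inner_smul_left, hR.antisymm x y]; ring
  pair_symm x y z w := by
    simp only [LinearMap.smul_apply, real_inner_smul_left, hR.pair_symm x y]
  bianchi x y z := by
    simp only [LinearMap.smul_apply, ← smul_add, hR.bianchi x y z, smul_zero]

theorem sub (hR : IsAlgebraicCurvature R) (hT : IsAlgebraicCurvature T) :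
    IsAlgebraicCurvature (R - T) := by
  have e : R - T = R + (-1 : ℝ) • T := by ext; simp [sub_eq_add_neg]
  exact e ▸ hR.add (hT.smul (-1))

/-- A curvature tensor is determined by its sectional curvatures. -/
theorem eq_zero_of_sectional (hR : IsAlgebraicCurvature R)
    (h : ∀ x y : V, ⟪R x y y, x⟫_ℝ = 0) : R = 0 := by
  have h1 : ∀ x y w : V, ⟪R x y y, w⟫_ℝ = 0 := fun x y w => by
    have e := h (x + w) y
    simp only [map_add, LinearMap.add_apply, inner_add_left, inner_add_right, h] at e
    have := hR.jacobi_symm y x w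
    linarith
  -- `R` is now alternating in all three arguments, so the three Bianchi terms coincide.
  have h2 : ∀ x y z w : V, ⟪R x y z, w⟫_ℝ = -⟪R x z y, w⟫_ℝ := fun x y z w => by
    have e := h1 x (y + z) w
    simp only [map_add, LinearMap.add_apply, inner_add_left, h1] at e
    linarith
  ext x y z
  refine ext_inner_right ℝ fun w => ?_
  have e := congrArg (fun u => ⟪u, w⟫_ℝ) (hR.bianchi x y z)
  simp only [inner_add_left, inner_zero_left] at e
  simp only [LinearMap.zero_apply, inner_zero_left]
  have e1 := h2 y z x w
  have e2 := hR.antisymm y x z w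
  have e3 := hR.antisymm z x y w
  have e4 := h2 x z y w
  linarith

end IsAlgebraicCurvature

theorem isAlgebraicCurvature_tensorOne : IsAlgebraicCurvature (tensorOne V) where
  antisymm x y z w := by
    simp only [tensorOne_apply, inner_sub_left, real_inner_smul_left]; ring
  pair_symm x y z w := by
    simp only [tensorOne_apply, inner_sub_left, real_inner_smul_left]
    rw [real_inner_comm x w, real_inner_comm x z, real_inner_comm y w, real_inner_comm y z]; ring
  bianchi x y z := by
    simp only [tensorOne_apply]
    rw [real_inner_comm y x, real_inner_comm z x, real_inner_comm z y]; module

theorem isAlgebraicCurvature_tensorOf {A : V →ₗ[ℝ] V}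
    (hA : ∀ x y, ⟪A x, y⟫_ℝ = -⟪x, A y⟫_ℝ) : IsAlgebraicCurvature (tensorOf A) where
  antisymm x y z w := by
    simp only [tensorOf_apply, inner_sub_left, inner_add_left, real_inner_smul_left]
    rw [← neg_neg ⟪x, A y⟫_ℝ, ← hA x y, real_inner_comm]; ring
  pair_symm x y z w := by
    simp only [tensorOf_apply, inner_sub_left, inner_add_left, real_inner_smul_left, hA]
    have e : ∀ a b : V, ⟪a, A b⟫_ℝ = -⟪b, A a⟫_ℝ := fun a b => by
      rw [← hA b a, real_inner_comm]
    rw [e z x, e z y, e w x, e w y]; ring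
  bianchi x y z := by
    simp only [tensorOf_apply]
    have e : ∀ a b : V, ⟪a, A b⟫_ℝ = -⟪b, A a⟫_ℝ := fun a b => by
      rw [← hA b a, real_inner_comm]
    rw [e y x, e z x, e z y]; module

theorem tensorOne_sectional (x y : V) :
    ⟪tensorOne V x y y, x⟫_ℝ = ⟪x, x⟫_ℝ * ⟪y, y⟫_ℝ - ⟪x, y⟫_ℝ ^ 2 := by
  simp only [tensorOne_apply, inner_sub_left, real_inner_smul_left, real_inner_comm x y]; ring

theorem tensorOf_sectional {A : V →ₗ[ℝ] V} (hA : ∀ x y, ⟪A x, y⟫_ℝ = -⟪x, A y⟫_ℝ) (x y : V) :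
    ⟪tensorOf A x y y, x⟫_ℝ = 3 * ⟪x, A y⟫_ℝ ^ 2 := by
  have h : ⟪y, A y⟫_ℝ = 0 := by
    have := hA y y
    rw [real_inner_comm] at this; linarith
  simp only [tensorOf_apply, inner_sub_left, inner_add_left, real_inner_smul_left, h,
    real_inner_comm x (A y)]; ring

theorem tensorOf_smul (c : ℝ) (A : V →ₗ[ℝ] V) : tensorOf (c • A) = c ^ 2 • tensorOf A := by
  ext x y z
  simp only [tensorOf_apply, LinearMap.smul_apply, real_inner_smul_right]; module

/-- Minors of a Jacobi operator of rank at most one, shifted by a multiple of the identity. -/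
theorem IsAlmostIsotropicWith.sq_eq_mul {R : Tensor V} {hR : IsAlgebraicCurvature R} {κ : ℝ}
    (h : IsAlmostIsotropicWith hR κ) (v x y : V) :
    ⟪(R - κ • tensorOne V) x v v, y⟫_ℝ ^ 2 =
      ⟪(R - κ • tensorOne V) x v v, x⟫_ℝ * ⟪(R - κ • tensorOne V) y v v, y⟫_ℝ := by
  have hT := hR.sub (isAlgebraicCurvature_tensorOne.smul κ)
  set T := R - κ • tensorOne V with hTdef
  have unit : ∀ v : V, ‖v‖ = 1 → ∃ a, ∀ w, ∃ c : ℝ, T w v v = c • a := by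
    intro v hv
    obtain ⟨a, ha⟩ := (rank_submodule_le_one_iff' _).mp (h v hv)
    refine ⟨a, fun w => ?_⟩
    have hvv : ⟪v, v⟫_ℝ = 1 := by rw [real_inner_self_eq_norm_sq, hv, one_pow]
    have hw : w - ⟪v, w⟫_ℝ • v ∈ (ℝ ∙ v)ᗮ := by
      rw [Submodule.mem_orthogonal_singleton_iff_inner_right, inner_sub_right,
        real_inner_smul_right, hvv, mul_one, sub_self]
    obtain ⟨c, hc⟩ := Submodule.mem_span_singleton.mp (ha ⟨⟨_, hw⟩, rfl⟩)
    refine ⟨c, ?_⟩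
    have hc' := congrArg Subtype.val hc
    simp only [LinearMap.sub_apply, LinearMap.smul_apply, LinearMap.id_apply, Submodule.coe_smul,
      Submodule.coe_sub, jacobiOperator_apply] at hc'
    -- Since `T(v,v) = 0`, the rank bound on the complement of `v` extends to all of `V`.
    have h0 : T w v v = T (w - ⟪v, w⟫_ℝ • v) v v := by
      simp [hT.apply_self]
    have h1 := Submodule.mem_orthogonal_singleton_iff_inner_left.mp hw
    rw [h0, hc', hTdef, LinearMap.sub_apply, LinearMap.sub_apply, LinearMap.sub_apply]
    simp only [LinearMap.smul_apply, tensorOne_apply, hvv, h1, one_smul, zero_smul, sub_zero]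
  have hv : ∃ a, ∀ w, ∃ c : ℝ, T w v v = c • a := by
    by_cases h0 : v = 0
    · exact ⟨0, fun w => ⟨0, by simp [h0]⟩⟩
    · obtain ⟨a, ha⟩ := unit ((‖v‖)⁻¹ • v) (norm_smul_inv_norm (𝕜 := ℝ) h0)
      refine ⟨a, fun w => ?_⟩
      obtain ⟨c, hc⟩ := ha w
      have hn : ‖v‖ ≠ 0 := norm_ne_zero_iff.mpr h0
      refine ⟨‖v‖ * ‖v‖ * c, ?_⟩
      rw [mul_smul, ← hc]
      simp only [map_smul, LinearMap.smul_apply, smul_smul]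
      rw [show ‖v‖ * ‖v‖ * (‖v‖⁻¹ * ‖v‖⁻¹) = 1 by field_simp, one_smul]
  obtain ⟨a, ha⟩ := hv
  obtain ⟨c, hc⟩ := ha x
  obtain ⟨d, hd⟩ := ha y
  have hs := hT.jacobi_symm v x y
  rw [pow_two]
  nth_rewrite 2 [hs]
  rw [hc, hd]
  simp only [real_inner_smul_left]; ring

/-- A curvature tensor whose Jacobi operators all have rank at most one comes from a
skew-symmetric endomorphism. -/
theorem IsAlgebraicCurvature.exists_eq_smul_tensorOf [FiniteDimensional ℝ V] {T : Tensor V}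
    (hT : IsAlgebraicCurvature T)
    (h : ∀ v x y : V, ⟪T x v v, y⟫_ℝ ^ 2 = ⟪T x v v, x⟫_ℝ * ⟪T y v v, y⟫_ℝ) :
    ∃ (τ : ℝ) (A : V →ₗ[ℝ] V), (τ = 1 ∨ τ = -1) ∧ (∀ x y, ⟪A x, y⟫_ℝ = -⟪x, A y⟫_ℝ) ∧
      T = τ • tensorOf A := by
  by_cases h0 : ∀ x y : V, ⟪T x y y, x⟫_ℝ = 0
  · refine ⟨1, 0, Or.inl rfl, by simp, ?_⟩
    rw [hT.eq_zero_of_sectional h0]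
    ext x y z
    simp [tensorOf_apply]
  push Not at h0
  obtain ⟨e₀, x₀, he₀⟩ := h0
  have hsec : ∀ x y : V, ⟪T x y y, x⟫_ℝ = ⟪T y x x, y⟫_ℝ := fun x y => by
    rw [hT.pair_symm x y y x]
  -- Rescaling `e₀` alone normalises the nonzero curvature to its sign.
  obtain ⟨τ, e, hτ, he⟩ : ∃ (τ : ℝ) (e : V), (τ = 1 ∨ τ = -1) ∧ ⟪T e x₀ x₀, e⟫_ℝ = τ := by
    set r := ⟪T e₀ x₀ x₀, e₀⟫_ℝ
    have hr : 0 < |r| := abs_pos.mpr he₀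
    refine ⟨r / |r|, (Real.sqrt |r|)⁻¹ • e₀, ?_, ?_⟩
    · rcases abs_choice r with hc | hc
      · left; rw [hc]; exact div_self he₀
      · right; rw [hc, div_neg, div_self he₀]
    · simp only [map_smul, LinearMap.smul_apply, real_inner_smul_left, real_inner_smul_right]
      rw [← mul_assoc, ← mul_inv, Real.mul_self_sqrt hr.le, mul_comm, ← div_eq_mul_inv]
  have hτ2 : τ * τ = 1 := by rcases hτ with rfl | rfl <;> norm_num
  let lam : V →ₗ[ℝ] ℝ := τ • (innerₗ V (T e x₀ x₀))
  have lam_apply : ∀ v, lam v = τ * ⟪T e x₀ x₀, v⟫_ℝ := fun v => rfl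
  -- The rank-one form of `T(·,x₀)x₀` is `τ lam²`, by the minor at `e, v`.
  have lam_sq : ∀ v, ⟪T x₀ v v, x₀⟫_ℝ = τ * lam v ^ 2 := fun v => by
    have := h x₀ e v
    rw [lam_apply, mul_pow, this, he, ← hsec]
    linear_combination (-(τ * τ) - 1) * ⟪T v x₀ x₀, v⟫_ℝ * hτ2
  have lam_e : lam e = 1 := by rw [lam_apply, he, hτ2]
  -- The quotient of `T(x₀,v)v` by `lam v`, read off by expanding at `v = (v - lam v • e) + lam v •
  -- e`.
  let l : V →ₗ[ℝ] V := T x₀ e + (T x₀).flip e - lam.smulRight (T x₀ e e)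
  have l_apply : ∀ v, l v = T x₀ e v + T x₀ v e - lam v • T x₀ e e := fun v => rfl
  -- On `ker lam` the diagonal entry at `x₀` vanishes, so the minors kill the whole vector
  -- `T(x₀,v)v`.
  have mixed : ∀ v y, ⟪T x₀ v v, y⟫_ℝ = lam v * ⟪l v, y⟫_ℝ := by
    intro v y
    have hz : lam (v - lam v • e) = 0 := by
      rw [map_sub, map_smul, lam_e, smul_eq_mul, mul_one, sub_self]
    have := h (v - lam v • e) x₀ y
    rw [lam_sq, hz] at this
    have hq : ⟪T x₀ (v - lam v • e) (v - lam v • e), y⟫_ℝ = 0 := by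
      apply pow_eq_zero_iff (two_ne_zero) |>.mp
      rw [this]; ring
    simp only [map_sub, map_smul, LinearMap.sub_apply, LinearMap.smul_apply, inner_sub_left,
      real_inner_smul_left] at hq
    rw [l_apply, inner_sub_left, inner_add_left, real_inner_smul_left]
    linear_combination hq
  have generic : ∀ v y, lam v ≠ 0 → ⟪T y v v, y⟫_ℝ = τ * ⟪l v, y⟫_ℝ ^ 2 := by
    intro v y hv
    have := h v x₀ y
    rw [lam_sq, mixed] at this
    apply mul_left_cancel₀ (pow_ne_zero 2 hv)
    linear_combination (-τ) * this - lam v ^ 2 * ⟪T y v v, y⟫_ℝ * hτ2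
  have main : ∀ v y, ⟪T y v v, y⟫_ℝ = τ * ⟪l v, y⟫_ℝ ^ 2 := by
    intro v y
    by_cases hv : lam v = 0
    · have key : ∀ t : ℝ, t ≠ 0 →
          ⟪T y (v + t • e) (v + t • e), y⟫_ℝ = τ * ⟪l (v + t • e), y⟫_ℝ ^ 2 := fun t ht =>
        generic _ _ (by rw [map_add, map_smul, lam_e, hv]; simpa using ht)
      -- Both sides are quadratic in `t`; their values at `1, -1, 2` determine the value at `0`,
      -- with Lagrange weights `1, 1/3, -1/3`.
      have k1 := key 1 one_ne_zero
      have k2 := key (-1) (by norm_num)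
      have k3 := key 2 two_ne_zero
      simp only [map_add, map_smul, LinearMap.add_apply, LinearMap.smul_apply, inner_add_left,
        real_inner_smul_left] at k1 k2 k3
      linear_combination k1 + (1 / 3) * k2 - (1 / 3) * k3
    · exact generic v y hv
  have alt : ∀ x, ⟪l x, x⟫_ℝ = 0 := by
    intro x
    have := main x x
    rw [hT.apply_self, LinearMap.zero_apply, inner_zero_left] at this
    have hτ0 : τ ≠ 0 := fun h' => by simp [h'] at hτ2
    simpa [hτ0] using this.symm
  have skew : ∀ x y, ⟪l x, y⟫_ℝ = -⟪x, l y⟫_ℝ := by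
    intro x y
    have := alt (x + y)
    simp only [map_add, inner_add_left, inner_add_right, alt] at this
    rw [real_inner_comm (l y) x]; linarith
  -- The factor `1/√3` absorbs the `3` in `tensorOf_sectional`.
  have hA : ∀ x y, ⟪((Real.sqrt 3)⁻¹ • l) x, y⟫_ℝ = -⟪x, ((Real.sqrt 3)⁻¹ • l) y⟫_ℝ := by
    intro x y
    simp only [LinearMap.smul_apply, real_inner_smul_left, real_inner_smul_right, skew x y]; ring
  refine ⟨τ, (Real.sqrt 3)⁻¹ • l, hτ, hA, sub_eq_zero.mp ?_⟩
  refine (hT.sub ((isAlgebraicCurvature_tensorOf hA).smul τ)).eq_zero_of_sectional fun x y => ?_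
  rw [LinearMap.sub_apply, LinearMap.sub_apply, LinearMap.sub_apply, inner_sub_left, main,
    LinearMap.smul_apply, LinearMap.smul_apply, LinearMap.smul_apply, real_inner_smul_left,
    tensorOf_sectional hA, LinearMap.smul_apply, real_inner_smul_right, mul_pow, inv_pow,
    Real.sq_sqrt (by norm_num), real_inner_comm]
  ring

/-- `κ R₁ + τ R_A` is almost isotropic with constant `κ`. -/
theorem isAlmostIsotropicWith_of_eq {R : Tensor V} (hR : IsAlgebraicCurvature R) {κ τ : ℝ}
    {A : V →ₗ[ℝ] V} (hA : ∀ x y, ⟪A x, y⟫_ℝ = -⟪x, A y⟫_ℝ)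
    (h : R = κ • tensorOne V + τ • tensorOf A) : IsAlmostIsotropicWith hR κ := by
  intro v hv
  have hvv : ⟪v, v⟫_ℝ = 1 := by rw [real_inner_self_eq_norm_sq, hv, one_pow]
  have hAv : ⟪v, A v⟫_ℝ = 0 := by
    have := hA v v
    rw [real_inner_comm] at this; linarith
  refine (rank_submodule_le_one_iff' _).mpr
    ⟨⟨A v, Submodule.mem_orthogonal_singleton_iff_inner_right.mpr hAv⟩, ?_⟩
  rintro _ ⟨w, rfl⟩
  -- For `w ⟂ v` one has `R_A(w,v)v = 3⟨w,Av⟩ Av`, so the image lies on the line of `A v`.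
  refine Submodule.mem_span_singleton.mpr ⟨3 * τ * ⟪(w : V), A v⟫_ℝ, Subtype.ext ?_⟩
  have hw := Submodule.mem_orthogonal_singleton_iff_inner_left.mp w.2
  simp only [LinearMap.sub_apply, LinearMap.smul_apply, LinearMap.id_apply, Submodule.coe_smul,
    Submodule.coe_sub, jacobiOperator_apply]
  rw [h]
  simp only [LinearMap.add_apply, LinearMap.smul_apply, tensorOne_apply, tensorOf_apply, hvv, hw,
    hAv]
  module

end Curvature

/-! ### The Kähler condition and its compatibility with `J` -/

section Kahler
variable {V : Type*} [NormedAddCommGroup V] [InnerProductSpace ℝ V]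

/-- A vector space is not the union of two proper subspaces, here the two kernels. -/
theorem eq_zero_or_eq_zero_of_forall {M N : Type*} [AddCommGroup M] [Module ℝ M]
    [AddCommGroup N] [Module ℝ N] (f g : M →ₗ[ℝ] N) (h : ∀ x, f x = 0 ∨ g x = 0) :
    f = 0 ∨ g = 0 := by
  by_contra! hc
  obtain ⟨a, ha⟩ := DFunLike.ne_iff.mp hc.1
  obtain ⟨b, hb⟩ := DFunLike.ne_iff.mp hc.2
  have ga := (h a).resolve_left ha
  have fb := (h b).resolve_right hb
  rcases h (a + b) with h' | h'
  · rw [map_add, fb, add_zero] at h'; exact ha h'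
  · rw [map_add, ga, zero_add] at h'; exact hb h'

/-- The difference of squares factors, so the sign can be chosen uniformly first in `y`, then in
`x`. -/
theorem eq_or_eq_neg_of_inner_sq (f g : V →ₗ[ℝ] V)
    (h : ∀ x y, ⟪f x, y⟫_ℝ ^ 2 = ⟪g x, y⟫_ℝ ^ 2) : f = g ∨ f = -g := by
  have h1 : ∀ x, (f - g) x = 0 ∨ (f + g) x = 0 := by
    intro x
    have := eq_zero_or_eq_zero_of_forall (innerₗ V ((f - g) x)) (innerₗ V ((f + g) x))
      (fun y => by
        rw [← mul_eq_zero]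
        simp only [innerₗ_apply_apply, LinearMap.sub_apply, LinearMap.add_apply, inner_sub_left,
          inner_add_left]
        linear_combination h x y)
    refine this.imp (fun h' => ?_) fun h' => ?_
    · exact inner_self_eq_zero (𝕜 := ℝ).mp (LinearMap.congr_fun h' _)
    · exact inner_self_eq_zero (𝕜 := ℝ).mp (LinearMap.congr_fun h' _)
  exact (eq_zero_or_eq_zero_of_forall _ _ h1).imp sub_eq_zero.mp eq_neg_of_add_eq_zero_left

namespace IsOrthogonalComplexStructure
variable {J : V →ₗ[ℝ] V}

theorem skew (hJ : IsOrthogonalComplexStructure J) (x y : V) : ⟪J x, y⟫_ℝ = -⟪x, J y⟫_ℝ := by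
  rw [← hJ.orthogonal x, hJ.sq, inner_neg_right, neg_neg]

theorem inner_self (hJ : IsOrthogonalComplexStructure J) (x : V) : ⟪x, J x⟫_ℝ = 0 := by
  have := hJ.skew x x
  rw [real_inner_comm] at this; linarith

theorem comp_skew (hJ : IsOrthogonalComplexStructure J) {S : V →ₗ[ℝ] V}
    (hS : ∀ x y, ⟪S x, y⟫_ℝ = ⟪x, S y⟫_ℝ) (hSJ : ∀ x, S (J x) = J (S x)) (x y : V) :
    ⟪(J ∘ₗ S) x, y⟫_ℝ = -⟪x, (J ∘ₗ S) y⟫_ℝ := by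
  rw [LinearMap.comp_apply, LinearMap.comp_apply, hJ.skew, hS, hSJ]

end IsOrthogonalComplexStructure

variable {J : V →ₗ[ℝ] V}

/-- Structure of Kähler almost isotropic curvature tensors. -/
theorem IsKahlerAlmostIsotropic.exists_symmetric [FiniteDimensional ℝ V]
    (hJ : IsOrthogonalComplexStructure J) {R : Tensor V} {κ : ℝ}
    (h : IsKahlerAlmostIsotropic J R κ) :
    ∃ (τ : ℝ) (S : V →ₗ[ℝ] V), (τ = 1 ∨ τ = -1) ∧ (∀ x y, ⟪S x, y⟫_ℝ = ⟪x, S y⟫_ℝ) ∧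
      (∀ x, S (J x) = J (S x)) ∧ R = κ • tensorOne V + τ • tensorOf (J ∘ₗ S) ∧
      ∀ (y : V) (μ : ℝ), ‖y‖ = 1 → S y = μ • y → ∀ x, ⟪x, y⟫_ℝ = 0 → ⟪x, J y⟫_ℝ = 0 →
        κ • x = (τ * μ) • S x := by
  obtain ⟨hR, hK, hI⟩ := h
  obtain ⟨τ, A, hτ, hA, hT⟩ := (hR.sub
    (isAlgebraicCurvature_tensorOne.smul κ)).exists_eq_smul_tensorOf hI.sq_eq_mul
  have hτ0 : τ ≠ 0 := by rcases hτ with rfl | rfl <;> norm_num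
  have hRA : R = κ • tensorOne V + τ • tensorOf A := by rw [← hT]; abel
  have apply : ∀ x y z, R x y z = κ • tensorOne V x y z + τ • tensorOf A x y z := by
    intro x y z; rw [hRA]; rfl
  have sec : ∀ x y, ⟪R x y y, x⟫_ℝ = ⟪R (J x) (J y) (J y), J x⟫_ℝ := by
    intro x y
    rw [hK x y y, hR.pair_symm, hK y x, hR.pair_symm, hR.antisymm, hR.antisymm_right, neg_neg]
  -- `J`-invariance of the sectional form at `(x, J y)`: the `R₁` parts cancel and only the squares
  -- remain.
  have sq : ∀ x y, ⟪A (J x), y⟫_ℝ ^ 2 = ⟪J (A x), y⟫_ℝ ^ 2 := by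
    intro x y
    have := sec x (J y)
    rw [apply, apply, inner_add_left, inner_add_left, real_inner_smul_left, real_inner_smul_left,
      real_inner_smul_left, real_inner_smul_left, tensorOne_sectional, tensorOne_sectional,
      tensorOf_sectional hA, tensorOf_sectional hA, hJ.orthogonal, hJ.orthogonal,
      hJ.orthogonal, hJ.sq, map_neg, inner_neg_right] at this
    rw [hJ.orthogonal y y, hJ.skew x y, inner_neg_right] at this
    rw [hA (J x), hJ.skew (A x), hA x]
    have h' : τ * (⟪J x, A y⟫_ℝ ^ 2 - ⟪x, A (J y)⟫_ℝ ^ 2) = 0 := by linarith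
    have := (mul_eq_zero.mp h').resolve_left hτ0
    linear_combination this
  have anti : ∀ y, ⟪y, A y⟫_ℝ = 0 := fun y => by
    have := hA y y
    rw [real_inner_comm] at this; linarith
  -- The Kähler identity `R(x,y)y = R(Jx,Jy)y` written out.
  have eqn : ∀ x y : V, κ • (⟪y, y⟫_ℝ • x - ⟪x, y⟫_ℝ • y + ⟪J x, y⟫_ℝ • J y) +
      τ • ((3 * ⟪x, A y⟫_ℝ - 2 * ⟪J x, A (J y)⟫_ℝ) • A y - ⟪J x, A y⟫_ℝ • A (J y)
        + ⟪J y, A y⟫_ℝ • A (J x)) = 0 := by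
    intro x y
    have := hK x y y
    rw [apply, apply] at this
    simp only [tensorOne_apply, tensorOf_apply, anti] at this
    have hy : ⟪J y, y⟫_ℝ = 0 := by rw [real_inner_comm, hJ.inner_self]
    rw [hy] at this
    rw [← sub_eq_zero] at this
    rw [← this]; module
  have comm : ∀ x, A (J x) = J (A x) := by
    rcases eq_or_eq_neg_of_inner_sq (A ∘ₗ J) (J ∘ₗ A) sq with hc | hc
    · exact LinearMap.congr_fun hc
    · have hc' : ∀ x, A (J x) = -J (A x) := LinearMap.congr_fun hc
      suffices ∀ y, A y = 0 by intro x; rw [this, this, map_zero]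
      intro y
      by_contra hy
      have hJy : J (A y) ≠ 0 := fun h0 => hy (by
        have := hJ.sq (A y)
        rw [h0, map_zero] at this; exact neg_eq_zero.mp this.symm)
      have j1 : ⟪J y, A y⟫_ℝ = 0 := by
        have e1 := hA (J y) y
        rw [hc', inner_neg_left, hJ.skew, neg_neg] at e1
        have e2 := hJ.skew y (A y)
        have e3 := real_inner_comm (J y) (A y)
        have e4 := hJ.skew (A y) y
        have e5 := real_inner_comm (A y) (J y)
        have e6 := real_inner_comm y (J (A y))
        have e7 := hA y (J y)
        rw [hc', inner_neg_right] at e7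
        linarith
      have j2 : ⟪y, J (A y)⟫_ℝ = 0 := by have := hJ.skew y (A y); linarith
      -- In the anticommuting case, `x = A y` and `x = J A y` give `κ|y|² = -5τ|Ay|²` and `κ|y|² =
      -- τ|Ay|²`, which is absurd when `A y ≠ 0`.
      have q1 := congrArg (fun u => ⟪u, A y⟫_ℝ) (eqn (A y) y)
      have q2 := congrArg (fun u => ⟪u, J (A y)⟫_ℝ) (eqn (J (A y)) y)
      have n1 := real_inner_self_pos.mpr hy
      have a1 : ⟪A y, J (A y)⟫_ℝ = 0 := hJ.inner_self _
      have a2 : ⟪J (A y), A y⟫_ℝ = 0 := by rw [real_inner_comm, a1]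
      have a3 : ⟪A y, y⟫_ℝ = 0 := by rw [real_inner_comm, anti]
      have a4 : ⟪J (A y), y⟫_ℝ = 0 := by rw [real_inner_comm, j2]
      simp only [inner_add_left, inner_sub_left, inner_neg_left, inner_neg_right, hc', j1, a1, a2,
        a3, a4, real_inner_smul_left, hJ.sq, hJ.orthogonal, inner_zero_left] at q1 q2
      have h1 : ⟪A y, A y⟫_ℝ * (κ * ⟪y, y⟫_ℝ + 5 * τ * ⟪A y, A y⟫_ℝ) = 0 := by
        linear_combination q1
      have h2 : ⟪A y, A y⟫_ℝ * (κ * ⟪y, y⟫_ℝ - τ * ⟪A y, A y⟫_ℝ) = 0 := by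
        linear_combination q2
      have h1' := (mul_eq_zero.mp h1).resolve_left n1.ne'
      have h2' := (mul_eq_zero.mp h2).resolve_left n1.ne'
      have h3 : τ * ⟪A y, A y⟫_ℝ = 0 := by linarith
      exact mul_ne_zero hτ0 n1.ne' h3
  have hAS : J ∘ₗ (-(J ∘ₗ A)) = A := by
    ext x; simp [hJ.sq]
  refine ⟨τ, -(J ∘ₗ A), hτ, ?_, ?_, ?_, ?_⟩
  · intro x y
    simp only [LinearMap.neg_apply, LinearMap.comp_apply, inner_neg_left, inner_neg_right]
    rw [hJ.skew, hA, comm]; ring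
  · intro x
    simp only [LinearMap.neg_apply, LinearMap.comp_apply, comm, map_neg]
  · rw [hAS, hRA]
  · intro y μ hy hSy x hxy hxJy
    have hAy : A y = μ • J y := by
      rw [← map_smul, ← hSy]; simp [hJ.sq]
    have hyy : ⟪y, y⟫_ℝ = 1 := by rw [real_inner_self_eq_norm_sq, hy, one_pow]
    have h1 : ⟪J x, y⟫_ℝ = 0 := by rw [hJ.skew, hxJy, neg_zero]
    have := eqn x y
    simp only [comm, hAy, map_smul, hJ.sq, hJ.orthogonal, real_inner_smul_right, inner_neg_right,
      hyy, hxy, hxJy, h1] at this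
    simp only [LinearMap.neg_apply, LinearMap.comp_apply]
    rw [← sub_eq_zero, ← this]
    module

/-- The Kähler condition for the tensors `κ R₁ + τ R_{JS}`. -/
theorem isKahler_of_symmetric (hJ : IsOrthogonalComplexStructure J) {S : V →ₗ[ℝ] V}
    (hS : ∀ x y, ⟪S x, y⟫_ℝ = ⟪x, S y⟫_ℝ) (hSJ : ∀ x, S (J x) = J (S x)) (κ τ : ℝ)
    (h : ∀ x y z : V, κ • (⟪x, z⟫_ℝ • y - ⟪y, z⟫_ℝ • x - ⟪J x, z⟫_ℝ • J y + ⟪J y, z⟫_ℝ • J x) =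
      τ • (⟪S x, z⟫_ℝ • S y - ⟪S y, z⟫_ℝ • S x
        - ⟪J (S x), z⟫_ℝ • J (S y) + ⟪J (S y), z⟫_ℝ • J (S x))) :
    IsKahler J (κ • tensorOne V + τ • tensorOf (J ∘ₗ S)) := by
  intro x y z
  have h0 := h x y z
  rw [← sub_eq_zero] at h0 ⊢
  simp only [LinearMap.add_apply, LinearMap.smul_apply, tensorOne_apply, tensorOf_apply,
    LinearMap.comp_apply, hSJ, hJ.sq, hJ.orthogonal, map_neg, inner_neg_right, hJ.skew, hS] at h0 ⊢
  rw [← neg_eq_zero, ← h0]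
  module

theorem isKahlerAlmostIsotropic_of_symmetric (hJ : IsOrthogonalComplexStructure J)
    {S : V →ₗ[ℝ] V}
    (hS : ∀ x y, ⟪S x, y⟫_ℝ = ⟪x, S y⟫_ℝ) (hSJ : ∀ x, S (J x) = J (S x)) (κ τ : ℝ)
    (h : ∀ x y z : V, κ • (⟪x, z⟫_ℝ • y - ⟪y, z⟫_ℝ • x - ⟪J x, z⟫_ℝ • J y + ⟪J y, z⟫_ℝ • J x) =
      τ • (⟪S x, z⟫_ℝ • S y - ⟪S y, z⟫_ℝ • S x
        - ⟪J (S x), z⟫_ℝ • J (S y) + ⟪J (S y), z⟫_ℝ • J (S x))) :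
    IsKahlerAlmostIsotropic J (κ • tensorOne V + τ • tensorOf (J ∘ₗ S)) κ :=
  ⟨(isAlgebraicCurvature_tensorOne.smul κ).add
      ((isAlgebraicCurvature_tensorOf (hJ.comp_skew hS hSJ)).smul τ),
    isKahler_of_symmetric hJ hS hSJ κ τ h,
    isAlmostIsotropicWith_of_eq _ (hJ.comp_skew hS hSJ) rfl⟩

theorem isKahlerAlmostIsotropic_smul (hJ : IsOrthogonalComplexStructure J) (κ : ℝ) :
    IsKahlerAlmostIsotropic J (κ • (tensorOne V + tensorOf J)) κ := by
  have := isKahlerAlmostIsotropic_of_symmetric hJ (S := LinearMap.id) (fun _ _ => rfl)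
    (fun _ => rfl) κ κ fun _ _ _ => rfl
  rw [LinearMap.comp_id] at this
  rwa [smul_add]

theorem IsOrthogonalComplexStructure.isHolomorphicPlane_span
    (hJ : IsOrthogonalComplexStructure J) {e : V} (he : ‖e‖ = 1) :
    IsHolomorphicPlane J (Submodule.span ℝ {e, J e}) where
  finrank_eq := by
    have hee : ⟪e, e⟫_ℝ = 1 := by rw [real_inner_self_eq_norm_sq, he, one_pow]
    have hli : LinearIndependent ℝ ![e, J e] := by
      refine LinearIndependent.pair_iff.mpr fun a b hab => ?_
      have h1 := congrArg (fun u => ⟪e, u⟫_ℝ) hab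
      have h2 := congrArg (fun u => ⟪J e, u⟫_ℝ) hab
      have h3 : ⟪J e, e⟫_ℝ = 0 := by rw [real_inner_comm, hJ.inner_self]
      simp only [inner_add_right, real_inner_smul_right, hJ.orthogonal, hee, hJ.inner_self, h3,
        inner_zero_right] at h1 h2
      exact ⟨by linarith, by linarith⟩
    have := finrank_span_eq_card hli
    rwa [Matrix.range_cons_cons_empty, Fintype.card_fin] at this
  invariant w hw := by
    obtain ⟨a, b, rfl⟩ := Submodule.mem_span_pair.mp hw
    refine Submodule.mem_span_pair.mpr ⟨-b, a, ?_⟩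
    rw [map_add, map_smul, map_smul, hJ.sq]; module

end Kahler

/-! ### Holomorphic planes, eigenvectors and dimension two -/

section Planes
variable {V : Type*} [NormedAddCommGroup V] [InnerProductSpace ℝ V] [FiniteDimensional ℝ V]

theorem exists_unit_orthogonal (s : Finset V) (h : s.card < Module.finrank ℝ V) :
    ∃ x : V, ‖x‖ = 1 ∧ ∀ y ∈ s, ⟪x, y⟫_ℝ = 0 := by
  have h1 := (Submodule.span ℝ (s : Set V)).finrank_add_finrank_orthogonal
  have h2 : Module.finrank ℝ (Submodule.span ℝ (s : Set V)) ≤ s.card :=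
    finrank_span_finset_le_card s
  have : Nontrivial (Submodule.span ℝ (s : Set V))ᗮ :=
    Module.finrank_pos_iff (R := ℝ).mp (by omega)
  obtain ⟨⟨x, hx⟩, hx0⟩ := exists_ne (0 : (Submodule.span ℝ (s : Set V))ᗮ)
  have hx0 : x ≠ 0 := fun h0 => hx0 (Subtype.ext h0)
  refine ⟨‖x‖⁻¹ • x, norm_smul_inv_norm (𝕜 := ℝ) hx0, fun y hy => ?_⟩
  rw [real_inner_smul_left, (Submodule.mem_orthogonal' _ _).mp hx y (Submodule.subset_span hy),
    mul_zero]

/-- By the spectral theorem, otherwise `S` would kill an orthonormal eigenbasis. -/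
theorem exists_unit_eigenvector {S : V →ₗ[ℝ] V} (hS : ∀ x y, ⟪S x, y⟫_ℝ = ⟪x, S y⟫_ℝ)
    (h0 : S ≠ 0) : ∃ (y : V) (μ : ℝ), ‖y‖ = 1 ∧ μ ≠ 0 ∧ S y = μ • y := by
  have hS' : S.IsSymmetric := hS
  by_contra! hc
  refine h0 ((hS'.eigenvectorBasis rfl).toBasis.ext fun i => ?_)
  have hi := hS'.apply_eigenvectorBasis rfl i
  rw [OrthonormalBasis.coe_toBasis, LinearMap.zero_apply]
  by_cases hμ : hS'.eigenvalues rfl i = 0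
  · rw [hi, hμ]; simp
  · exact absurd hi (hc _ _ ((hS'.eigenvectorBasis rfl).norm_eq_one i) hμ)

variable {J : V →ₗ[ℝ] V}

namespace IsHolomorphicPlane
variable {W W₁ W₂ : Submodule ℝ V}

theorem eq_span (hJ : IsOrthogonalComplexStructure J) (hW : IsHolomorphicPlane J W) {e : V}
    (he : ‖e‖ = 1) (heW : e ∈ W) : W = Submodule.span ℝ {e, J e} := by
  refine (Submodule.eq_of_le_of_finrank_eq (Submodule.span_le.mpr ?_) ?_).symm
  · rintro x (rfl | rfl)
    · exact heW
    · exact hW.invariant _ heW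
  · rw [hW.finrank_eq, (hJ.isHolomorphicPlane_span he).finrank_eq]

theorem proj_eq (hJ : IsOrthogonalComplexStructure J) (hW : IsHolomorphicPlane J W) {e : V}
    (he : ‖e‖ = 1) (heW : e ∈ W) (x : V) :
    proj W x = ⟪e, x⟫_ℝ • e + ⟪J e, x⟫_ℝ • J e := by
  have hee : ⟪e, e⟫_ℝ = 1 := by rw [real_inner_self_eq_norm_sq, he, one_pow]
  have h3 : ⟪J e, e⟫_ℝ = 0 := by rw [real_inner_comm, hJ.inner_self]
  refine Submodule.eq_starProjection_of_mem_of_inner_eq_zero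
    (W.add_mem (W.smul_mem _ heW) (W.smul_mem _ (hW.invariant _ heW))) fun w hw => ?_
  rw [hW.eq_span hJ he heW] at hw
  obtain ⟨a, b, rfl⟩ := Submodule.mem_span_pair.mp hw
  simp only [inner_add_right, inner_sub_left, inner_add_left, real_inner_smul_left,
    real_inner_smul_right, hJ.orthogonal, hee, hJ.inner_self, h3]
  rw [real_inner_comm, real_inner_comm (J e)]; ring

theorem exists_unit (hW : IsHolomorphicPlane J W) : ∃ e ∈ W, ‖e‖ = 1 := by
  have : Nontrivial W := Module.finrank_pos_iff (R := ℝ).mp (by rw [hW.finrank_eq]; norm_num)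
  obtain ⟨x, hx⟩ := exists_norm_eq W (zero_le_one (α := ℝ))
  exact ⟨x, x.2, hx⟩

theorem proj_symm (hJ : IsOrthogonalComplexStructure J) (hW : IsHolomorphicPlane J W) (x y : V) :
    ⟪proj W x, y⟫_ℝ = ⟪x, proj W y⟫_ℝ := by
  obtain ⟨e, heW, he⟩ := hW.exists_unit
  rw [hW.proj_eq hJ he heW, hW.proj_eq hJ he heW, inner_add_left, inner_add_right,
    real_inner_smul_left, real_inner_smul_left, real_inner_smul_right, real_inner_smul_right,
    real_inner_comm x, real_inner_comm x]
  ring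

theorem proj_comm (hJ : IsOrthogonalComplexStructure J) (hW : IsHolomorphicPlane J W) (x : V) :
    proj W (J x) = J (proj W x) := by
  obtain ⟨e, heW, he⟩ := hW.exists_unit
  have : ⟪e, J x⟫_ℝ = -⟪J e, x⟫_ℝ := by rw [hJ.skew, neg_neg]
  rw [hW.proj_eq hJ he heW, hW.proj_eq hJ he heW, map_add, map_smul, map_smul, hJ.sq,
    hJ.orthogonal, this]
  module

/-- `J` acts on the plane with determinant one, so `a∧b = Ja∧Jb` for the projections `a, b`. -/
theorem proj_wedge (hJ : IsOrthogonalComplexStructure J) (hW : IsHolomorphicPlane J W)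
    (x y z : V) :
    ⟪proj W x, z⟫_ℝ • proj W y - ⟪proj W y, z⟫_ℝ • proj W x
      - ⟪J (proj W x), z⟫_ℝ • J (proj W y) + ⟪J (proj W y), z⟫_ℝ • J (proj W x) = 0 := by
  obtain ⟨e, heW, he⟩ := hW.exists_unit
  simp only [hW.proj_eq hJ he heW, map_add, map_smul, hJ.sq, inner_add_left,
    real_inner_smul_left, inner_neg_left]
  module

theorem orthogonal (hJ : IsOrthogonalComplexStructure J) (hW : IsHolomorphicPlane J W)
    (hV : Module.finrank ℝ V = 4) : IsHolomorphicPlane J Wᗮ where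
  finrank_eq := by
    have := W.finrank_add_finrank_orthogonal
    rw [hW.finrank_eq] at this; omega
  invariant w hw := (Submodule.mem_orthogonal _ _).mpr fun u hu => by
    have h := (Submodule.mem_orthogonal _ _).mp hw _ (hW.invariant u hu)
    rw [hJ.skew, neg_eq_zero] at h
    exact h

theorem proj_add_proj (hW₁ : IsHolomorphicPlane J W₁)
    (hW₂ : IsHolomorphicPlane J W₂) (h : W₁ ⟂ W₂) (hV : Module.finrank ℝ V = 4) (x : V) :
    proj W₁ x + proj W₂ x = x := by
  have e : W₂ = W₁ᗮ := by
    refine Submodule.eq_of_le_of_finrank_eq h.symm ?_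
    have := W₁.finrank_add_finrank_orthogonal
    rw [hW₁.finrank_eq] at this
    rw [hW₂.finrank_eq]; omega
  subst e
  simp only [proj, ContinuousLinearMap.coe_coe]
  rw [Submodule.starProjection_orthogonal_val]; abel

end IsHolomorphicPlane

theorem inner_sub_proj_span (J : V →ₗ[ℝ] V) (e x : V) :
    ⟪x - proj (Submodule.span ℝ {e, J e}) x, e⟫_ℝ = 0 ∧
      ⟪x - proj (Submodule.span ℝ {e, J e}) x, J e⟫_ℝ = 0 := by
  have h := (Submodule.mem_orthogonal' _ _).mp
    (Submodule.sub_starProjection_mem_orthogonal (K := Submodule.span ℝ {e, J e}) x)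
  exact ⟨h e (Submodule.subset_span (by simp)), h (J e) (Submodule.subset_span (by simp))⟩

theorem apply_proj_span (hJ : IsOrthogonalComplexStructure J) {e : V} (he : ‖e‖ = 1)
    {S : V →ₗ[ℝ] V} (hSJ : ∀ x, S (J x) = J (S x)) {μ : ℝ} (hS : S e = μ • e) (x : V) :
    S (proj (Submodule.span ℝ {e, J e}) x) = μ • proj (Submodule.span ℝ {e, J e}) x := by
  rw [(hJ.isHolomorphicPlane_span he).proj_eq hJ he (Submodule.subset_span (by simp)), map_add,
    map_smul, map_smul, hSJ, hS, map_smul]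
  module

/-- In the basis `e, J e`, every sectional expression is a multiple of the single one assumed to
vanish. -/
theorem IsAlgebraicCurvature.eq_zero_of_finrank_two (hJ : IsOrthogonalComplexStructure J)
    (hV : Module.finrank ℝ V = 2) {T : Tensor V} (hT : IsAlgebraicCurvature T) {e : V}
    (he : ‖e‖ = 1) (h : ⟪T e (J e) (J e), e⟫_ℝ = 0) : T = 0 := by
  have htop : Submodule.span ℝ {e, J e} = ⊤ :=
    Submodule.eq_top_of_finrank_eq (by rw [(hJ.isHolomorphicPlane_span he).finrank_eq, hV])
  have coord : ∀ x : V, ∃ a b : ℝ, a • e + b • J e = x := fun x =>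
    Submodule.mem_span_pair.mp (htop ▸ Submodule.mem_top)
  refine hT.eq_zero_of_sectional fun x y => ?_
  obtain ⟨a, b, rfl⟩ := coord x
  obtain ⟨c, d, rfl⟩ := coord y
  have h1 := hT.antisymm_right e (J e) (J e) e
  have h2 := hT.antisymm_right e (J e) e e
  have h3 := hT.antisymm_right e (J e) (J e) (J e)
  simp only [map_add, map_smul, LinearMap.add_apply, LinearMap.smul_apply, hT.apply_self,
    hT.swap (J e) e, LinearMap.neg_apply, LinearMap.zero_apply, inner_add_left, inner_add_right,
    real_inner_smul_left, real_inner_smul_right, inner_neg_left, inner_zero_left, smul_neg,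
    smul_zero]
  have h4 : ⟪T e (J e) e, J e⟫_ℝ = 0 := by linarith
  have h5 : ⟪T e (J e) e, e⟫_ℝ = 0 := by linarith
  have h6 : ⟪T e (J e) (J e), J e⟫_ℝ = 0 := by linarith
  rw [h, h4, h5, h6]; ring

theorem tensorOf_eq_of_finrank_two (hJ : IsOrthogonalComplexStructure J)
    (hV : Module.finrank ℝ V = 2) : tensorOf J = (3 : ℝ) • tensorOne V := by
  obtain ⟨e, he, -⟩ := exists_unit_orthogonal (∅ : Finset V) (by simp [hV])
  have hee : ⟪e, e⟫_ℝ = 1 := by rw [real_inner_self_eq_norm_sq, he, one_pow]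
  refine sub_eq_zero.mp (((isAlgebraicCurvature_tensorOf hJ.skew).sub
    (isAlgebraicCurvature_tensorOne.smul 3)).eq_zero_of_finrank_two hJ hV he ?_)
  simp only [LinearMap.sub_apply, LinearMap.smul_apply, inner_sub_left, real_inner_smul_left,
    tensorOf_sectional hJ.skew, tensorOne_sectional, hJ.orthogonal, hJ.sq, inner_neg_right, hee,
    hJ.inner_self]
  norm_num

theorem smul_tensorOne_eq_of_finrank_two (hJ : IsOrthogonalComplexStructure J)
    (hV : Module.finrank ℝ V = 2) (κ : ℝ) :
    κ • tensorOne V = (κ / 4) • (tensorOne V + tensorOf J) := by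
  rw [tensorOf_eq_of_finrank_two hJ hV]
  ext x y z
  simp only [LinearMap.smul_apply, LinearMap.add_apply]
  module

/-- The complement of a unit vector is a line, so the rank bound is automatic. -/
theorem isAlmostIsotropicWith_of_finrank_two (hV : Module.finrank ℝ V = 2) {R : Tensor V}
    (hR : IsAlgebraicCurvature R) (κ : ℝ) : IsAlmostIsotropicWith hR κ := by
  intro v hv
  have : Fact (Module.finrank ℝ V = 1 + 1) := ⟨hV⟩
  have hv0 : v ≠ 0 := fun h => by simp [h] at hv
  refine (LinearMap.rank_le_domain _).trans ?_
  rw [← Module.finrank_eq_rank, Submodule.finrank_orthogonal_span_singleton (n := 1) hv0]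
  norm_num

end Planes

/-! ### Classification by dimension -/

section Classification
variable {V : Type*} [NormedAddCommGroup V] [InnerProductSpace ℝ V] [FiniteDimensional ℝ V]
  {J : V →ₗ[ℝ] V} {R : Tensor V} {κ : ℝ}

theorem isKahlerAlmostIsotropic_smul_tensorOne (hJ : IsOrthogonalComplexStructure J)
    (hV : Module.finrank ℝ V = 2) (κ₀ κ : ℝ) :
    IsKahlerAlmostIsotropic J (κ₀ • tensorOne V) κ := by
  refine ⟨isAlgebraicCurvature_tensorOne.smul κ₀, ?_, isAlmostIsotropicWith_of_finrank_two hV _ κ⟩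
  -- Rewritten as a multiple of `R₁ + R_J`, the tensor is visibly Kähler.
  rw [smul_tensorOne_eq_of_finrank_two hJ hV]
  exact (isKahlerAlmostIsotropic_smul hJ _).choose_spec.1

theorem eq_smul_tensorOne_of_finrank_two (hJ : IsOrthogonalComplexStructure J)
    (hV : Module.finrank ℝ V = 2) (hR : IsAlgebraicCurvature R) {e : V} (he : ‖e‖ = 1) :
    R = ⟪R e (J e) (J e), e⟫_ℝ • tensorOne V := by
  have hee : ⟪e, e⟫_ℝ = 1 := by rw [real_inner_self_eq_norm_sq, he, one_pow]
  refine sub_eq_zero.mp ((hR.sub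
    (isAlgebraicCurvature_tensorOne.smul _)).eq_zero_of_finrank_two hJ hV he ?_)
  simp only [LinearMap.sub_apply, LinearMap.smul_apply, inner_sub_left, real_inner_smul_left,
    tensorOne_sectional, hJ.orthogonal, hee, hJ.inner_self]
  ring

theorem classification_finrank_two (hJ : IsOrthogonalComplexStructure J)
    (hV : Module.finrank ℝ V = 2) :
    IsKahlerAlmostIsotropic J R κ ↔
      ∃! κ₀ : ℝ, R = κ₀ • tensorOne V ∧ R = (κ₀ / 4) • (tensorOne V + tensorOf J) := by
  obtain ⟨e, he, -⟩ := exists_unit_orthogonal (∅ : Finset V) (by simp [hV])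
  have hee : ⟪e, e⟫_ℝ = 1 := by rw [real_inner_self_eq_norm_sq, he, one_pow]
  constructor
  · rintro ⟨hR, -, -⟩
    have h := eq_smul_tensorOne_of_finrank_two hJ hV hR he
    refine ⟨_, ⟨h, h.trans (smul_tensorOne_eq_of_finrank_two hJ hV _)⟩, ?_⟩
    rintro c ⟨hc, -⟩
    rw [hc]
    simp only [LinearMap.smul_apply, real_inner_smul_left, tensorOne_sectional, hJ.orthogonal,
      hee, hJ.inner_self]
    ring
  · rintro ⟨c, ⟨rfl, -⟩, -⟩
    exact isKahlerAlmostIsotropic_smul_tensorOne hJ hV c κ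

theorem classification_finrank_two_of_sectional (hJ : IsOrthogonalComplexStructure J)
    (hV : Module.finrank ℝ V = 2) :
    IsKahlerAlmostIsotropic J R κ ∧ HasSectionalCurvature R κ ↔
      R = κ • tensorOne V ∧ R = (κ / 4) • (tensorOne V + tensorOf J) := by
  obtain ⟨e, he, -⟩ := exists_unit_orthogonal (∅ : Finset V) (by simp [hV])
  constructor
  · rintro ⟨⟨hR, -, -⟩, hs⟩
    have h := eq_smul_tensorOne_of_finrank_two hJ hV hR he
    have hJe : ‖J e‖ = 1 := by
      rw [norm_eq_sqrt_real_inner, hJ.orthogonal, ← norm_eq_sqrt_real_inner, he]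
    rw [hs e (J e) he hJe (hJ.inner_self e)] at h
    exact ⟨h, h.trans (smul_tensorOne_eq_of_finrank_two hJ hV _)⟩
  · rintro ⟨rfl, -⟩
    refine ⟨isKahlerAlmostIsotropic_smul_tensorOne hJ hV κ κ, fun x y hx hy hxy => ?_⟩
    simp only [LinearMap.smul_apply, real_inner_smul_left, tensorOne_sectional,
      real_inner_self_eq_norm_sq, hx, hy, hxy]
    ring

theorem classification_finrank_four (hJ : IsOrthogonalComplexStructure J)
    (hV : Module.finrank ℝ V = 4) (hκ : κ ≠ 0) :
    IsKahlerAlmostIsotropic J R κ ↔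
      ∃ (τ μ₁ μ₂ : ℝ) (W₁ W₂ : Submodule ℝ V), (τ = 1 ∨ τ = -1) ∧
        IsHolomorphicPlane J W₁ ∧ IsHolomorphicPlane J W₂ ∧ W₁ ⟂ W₂ ∧ μ₁ * μ₂ = κ / τ ∧
        R = κ • tensorOne V + τ • tensorOf (J ∘ₗ (μ₁ • proj W₁ + μ₂ • proj W₂)) := by
  classical
  constructor
  · intro h
    obtain ⟨τ, S, hτ, hS, hSJ, hR, key⟩ := h.exists_symmetric hJ
    have hτ0 : τ ≠ 0 := by rcases hτ with rfl | rfl <;> norm_num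
    -- If `S = 0`, the eigenvector rule with `μ = 0` reads `κ x = 0` for some `x ≠ 0`.
    have hS0 : S ≠ 0 := by
      rintro rfl
      obtain ⟨y, hy, -⟩ := exists_unit_orthogonal (∅ : Finset V) (by simp [hV])
      obtain ⟨x, hx, hxy⟩ := exists_unit_orthogonal {y, J y}
        (lt_of_le_of_lt Finset.card_le_two (by omega))
      have := key y 0 hy (by simp) x (hxy y (by simp)) (hxy (J y) (by simp))
      have hx0 : x ≠ 0 := fun h => by simp [h] at hx
      simp [hκ, hx0] at this
    obtain ⟨y, μ, hy, hμ, hSy⟩ := exists_unit_eigenvector hS hS0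
    have hW := hJ.isHolomorphicPlane_span hy
    have hW' := hW.orthogonal hJ hV
    have hWW : Submodule.span ℝ {y, J y} ⟂ (Submodule.span ℝ {y, J y})ᗮ :=
      Submodule.isOrtho_orthogonal_right _
    refine ⟨τ, μ, κ / (τ * μ), _, _, hτ, hW, hW', hWW, by field_simp, ?_⟩
    have hSeq : S = μ • proj (Submodule.span ℝ {y, J y}) +
        (κ / (τ * μ)) • proj (Submodule.span ℝ {y, J y})ᗮ := by
      ext x
      have hx := hW.proj_add_proj hW' hWW hV x
      have ho := inner_sub_proj_span J y x
      rw [← eq_sub_iff_add_eq'.mpr hx] at ho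
      have hk := key y μ hy hSy _ ho.1 ho.2
      have hk' : S (proj (Submodule.span ℝ {y, J y})ᗮ x) =
          (κ / (τ * μ)) • proj (Submodule.span ℝ {y, J y})ᗮ x := by
        rw [div_eq_inv_mul, mul_smul, hk, smul_smul, inv_mul_cancel₀ (mul_ne_zero hτ0 hμ),
          one_smul]
      nth_rewrite 1 [← hx]
      rw [map_add, apply_proj_span hJ hy hSJ hSy, hk']
      rfl
    rw [← hSeq]
    exact hR
  · rintro ⟨τ, μ₁, μ₂, W₁, W₂, hτ, h₁, h₂, hW, hμ, rfl⟩
    have hτ0 : τ ≠ 0 := by rcases hτ with rfl | rfl <;> norm_num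
    have hκτ : κ = τ * μ₁ * μ₂ := by
      rw [mul_assoc, hμ, mul_div_cancel₀ _ hτ0]
    refine isKahlerAlmostIsotropic_of_symmetric hJ ?_ ?_ κ τ ?_
    · intro x y
      simp only [LinearMap.add_apply, LinearMap.smul_apply, inner_add_left, inner_add_right,
        real_inner_smul_left, real_inner_smul_right, h₁.proj_symm hJ, h₂.proj_symm hJ]
    · intro x
      simp only [LinearMap.add_apply, LinearMap.smul_apply, map_add, map_smul, h₁.proj_comm hJ,
        h₂.proj_comm hJ]
    · intro x y z
      have e₁ := h₁.proj_wedge hJ x y z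
      have e₂ := h₂.proj_wedge hJ x y z
      have hx := h₁.proj_add_proj h₂ hW hV x
      have hy := h₁.proj_add_proj h₂ hW hV y
      simp only [LinearMap.add_apply, LinearMap.smul_apply]
      generalize proj W₁ x = a at *
      generalize proj W₂ x = b at *
      generalize proj W₁ y = c at *
      generalize proj W₂ y = d at *
      subst hx hy hκτ
      simp only [map_add, map_smul, inner_add_left, real_inner_smul_left]
      -- As `κ = τ μ₁ μ₂`, the mixed `W₁`–`W₂` terms cancel; the pure terms keep the coefficients `κ
      -- - τ μᵢ²` and vanish by `proj_wedge`.
      linear_combination (norm := module)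
        (τ * μ₁ * μ₂ - τ * μ₁ ^ 2) • e₁ + (τ * μ₁ * μ₂ - τ * μ₂ ^ 2) • e₂

theorem classification_six_le_finrank (hJ : IsOrthogonalComplexStructure J)
    (hV : 6 ≤ Module.finrank ℝ V) (hκ : κ ≠ 0) :
    IsKahlerAlmostIsotropic J R κ ↔ R = κ • (tensorOne V + tensorOf J) := by
  classical
  refine ⟨fun h => ?_, fun h => h ▸ isKahlerAlmostIsotropic_smul hJ κ⟩
  obtain ⟨τ, S, hτ, hS, hSJ, hR, key⟩ := h.exists_symmetric hJ
  have hS0 : S ≠ 0 := by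
    rintro rfl
    obtain ⟨y, hy, -⟩ := exists_unit_orthogonal (∅ : Finset V) (by simp; omega)
    obtain ⟨x, hx, hxy⟩ := exists_unit_orthogonal {y, J y}
      (lt_of_le_of_lt Finset.card_le_two (by omega))
    have := key y 0 hy (by simp) x (hxy y (by simp)) (hxy (J y) (by simp))
    have hx0 : x ≠ 0 := fun h => by simp [h] at hx
    simp [hκ, hx0] at this
  obtain ⟨y, μ, hy, hμ, hSy⟩ := exists_unit_eigenvector hS hS0
  have hτμ : τ * μ ≠ 0 := mul_ne_zero (by rcases hτ with rfl | rfl <;> norm_num) hμ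
  obtain ⟨x₁, hx₁, hxy₁⟩ := exists_unit_orthogonal {y, J y}
    (lt_of_le_of_lt Finset.card_le_two (by omega))
  obtain ⟨x₂, hx₂, hxy₂⟩ := exists_unit_orthogonal {y, J y, x₁, J x₁}
    (lt_of_le_of_lt Finset.card_le_four (by omega))
  have hx₂0 : x₂ ≠ 0 := fun h => by simp [h] at hx₂
  have compl : ∀ x, ⟪x, y⟫_ℝ = 0 → ⟪x, J y⟫_ℝ = 0 → S x = (κ / (τ * μ)) • x := by
    intro x h1 h2
    rw [div_eq_inv_mul, mul_smul, key y μ hy hSy x h1 h2, smul_smul, inv_mul_cancel₀ hτμ, one_smul]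
  have h1 := compl x₁ (hxy₁ y (by simp)) (hxy₁ (J y) (by simp))
  have h2 := compl x₂ (hxy₂ y (by simp)) (hxy₂ (J y) (by simp))
  have h3 := key x₁ _ hx₁ h1 x₂ (hxy₂ x₁ (by simp)) (hxy₂ (J x₁) (by simp))
  rw [h2, smul_smul] at h3
  have h4 := smul_left_injective ℝ hx₂0 h3
  have hμ2 : τ * μ ^ 2 = κ := by
    have hτ0 := left_ne_zero_of_mul hτμ
    field_simp at h4
    exact h4
  have hκμ : κ / (τ * μ) = μ := by
    rw [div_eq_iff hτμ, ← hμ2]; ring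
  have hSμ : J ∘ₗ S = μ • J := by
    ext x
    have ho := inner_sub_proj_span J y x
    have e1 := compl _ ho.1 ho.2
    rw [map_sub, apply_proj_span hJ hy hSJ hSy, hκμ, smul_sub, sub_left_inj] at e1
    rw [LinearMap.comp_apply, e1, map_smul, LinearMap.smul_apply]
  rw [hR, hSμ, tensorOf_smul, smul_smul, hμ2, ← smul_add]

theorem classification_zero (hJ : IsOrthogonalComplexStructure J)
    (hV : 4 ≤ Module.finrank ℝ V) :
    IsKahlerAlmostIsotropic J R 0 ↔
      ∃ (c : ℝ) (W : Submodule ℝ V), IsHolomorphicPlane J W ∧ R = c • tensorOf (J ∘ₗ proj W) := by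
  constructor
  · intro h
    obtain ⟨τ, S, hτ, hS, hSJ, hR, key⟩ := h.exists_symmetric hJ
    by_cases hS0 : S = 0
    · obtain ⟨y, hy, -⟩ := exists_unit_orthogonal (∅ : Finset V) (by simp; omega)
      refine ⟨0, _, hJ.isHolomorphicPlane_span hy, ?_⟩
      rw [hR, hS0]
      ext x y z
      simp [tensorOf_apply]
    · obtain ⟨y, μ, hy, hμ, hSy⟩ := exists_unit_eigenvector hS hS0
      have hτμ : τ * μ ≠ 0 := mul_ne_zero (by rcases hτ with rfl | rfl <;> norm_num) hμ
      -- With `κ = 0` the rule kills `S` off the plane, and `R_A` is quadratic in `A`, whence `μ²`.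
      refine ⟨τ * μ ^ 2, _, hJ.isHolomorphicPlane_span hy, ?_⟩
      have hSeq : J ∘ₗ S = μ • (J ∘ₗ proj (Submodule.span ℝ {y, J y})) := by
        ext x
        have ho := inner_sub_proj_span J y x
        have e1 := key y μ hy hSy _ ho.1 ho.2
        rw [zero_smul, eq_comm, smul_eq_zero_iff_right hτμ, map_sub,
          apply_proj_span hJ hy hSJ hSy, sub_eq_zero] at e1
        rw [LinearMap.comp_apply, e1, map_smul]
        rfl
      rw [hR, hSeq, tensorOf_smul, smul_smul, zero_smul, zero_add]
  · rintro ⟨c, W, hW, rfl⟩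
    have := isKahlerAlmostIsotropic_of_symmetric hJ (hW.proj_symm hJ) (hW.proj_comm hJ) 0 c
      fun x y z => by rw [hW.proj_wedge hJ, zero_smul, smul_zero]
    rwa [zero_smul, zero_add] at this

end Classification

end AlmostIso

theorem mainTheorem2 {V : Type*} [NormedAddCommGroup V] [InnerProductSpace ℝ V]
    [FiniteDimensional ℝ V] (J : V →ₗ[ℝ] V) (hJ : AlmostIso.IsOrthogonalComplexStructure J)
    (R : AlmostIso.Tensor V) (κ : ℝ) :
    (Module.finrank ℝ V = 2 →
      (AlmostIso.IsKahlerAlmostIsotropic J R κ ↔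
        ∃! κ₀ : ℝ, R = κ₀ • AlmostIso.tensorOne V ∧
          R = (κ₀ / 4) • (AlmostIso.tensorOne V + AlmostIso.tensorOf J)) ∧
      (AlmostIso.IsKahlerAlmostIsotropic J R κ ∧ AlmostIso.HasSectionalCurvature R κ ↔
        R = κ • AlmostIso.tensorOne V ∧
          R = (κ / 4) • (AlmostIso.tensorOne V + AlmostIso.tensorOf J))) ∧
    (Module.finrank ℝ V = 4 → κ ≠ 0 →
      (AlmostIso.IsKahlerAlmostIsotropic J R κ ↔
        ∃ (τ μ₁ μ₂ : ℝ) (W₁ W₂ : Submodule ℝ V),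
          (τ = 1 ∨ τ = -1) ∧
          AlmostIso.IsHolomorphicPlane J W₁ ∧ AlmostIso.IsHolomorphicPlane J W₂ ∧
          W₁ ⟂ W₂ ∧ μ₁ * μ₂ = κ / τ ∧
          R = κ • AlmostIso.tensorOne V +
            τ • AlmostIso.tensorOf
              (J ∘ₗ (μ₁ • AlmostIso.proj W₁ + μ₂ • AlmostIso.proj W₂)))) ∧
    (6 ≤ Module.finrank ℝ V → κ ≠ 0 →
      (AlmostIso.IsKahlerAlmostIsotropic J R κ ↔
        R = κ • (AlmostIso.tensorOne V + AlmostIso.tensorOf J))) ∧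
    (4 ≤ Module.finrank ℝ V → κ = 0 →
      (AlmostIso.IsKahlerAlmostIsotropic J R κ ↔
        ∃ (c : ℝ) (W : Submodule ℝ V), AlmostIso.IsHolomorphicPlane J W ∧
          R = c • AlmostIso.tensorOf (J ∘ₗ AlmostIso.proj W))) := by
  refine ⟨fun hV => ⟨AlmostIso.classification_finrank_two hJ hV,
    AlmostIso.classification_finrank_two_of_sectional hJ hV⟩,
    fun hV hκ => AlmostIso.classification_finrank_four hJ hV hκ,
    fun hV hκ => AlmostIso.classification_six_le_finrank hJ hV hκ, ?_⟩
  rintro hV rfl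
  exact AlmostIso.classification_zero hJ hV
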